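/- All graphs are finite, simple and undirected. For a graph $X$ with adjacency matrix $A(X)$, let $U(t) = e^{-\mathrm{i} t A(X)}$ for $t \in \mathbb{R}$. The graph $X$ has \emph{perfect state transfer} if there are two distinct vertices $u, v$ of $X$ and a time $\tau \in \mathbb{R}$ such that the $(v,u)$-entry of $U(\tau)$ is a complex number of absolute value $1$. The \emph{corona} $G \circ H$ has vertex set $V(G) \times (\{0\} \cup V(H))$, where $0 \notin V(H)$; vertices $(v,w)$ and $(v',w')$ are adjacent if and only if $w = w' = 0$ and $v, v'$ are adjacent in $G$, or $v = v'$ and $w, w' \in V(H)$ are adjacent in $H$, or $v = v'$ and exactly one of $w, w'$ is $0$. Let $\overline{K}_m$ be the graph with $m$ vertices and no edges, and let $K_{1,n}$ be the star with $n$ leaves. \textbf{Theorem.} \begin{enumerate} \item If $G$ is a connected graph on at least two vertices and $m$ is either $1$ or a prime number, then $G \circ \overline{K}_m$ has no perfect state transfer. \item For all integers $n, m \ge 1$, the graph $K_{1,n} \circ \overline{K}_m$ has no perfect state transfer. \end{enumerate} -/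

import Mathlib

namespace QuantumWalk

/-- The Frucht-Harary corona `G ∘ H` on the vertex set `V(G) × ({0} ∪ V(H))`; here `none` plays
the role of the extra symbol `0`. -/
def corona {V W : Type*} (G : SimpleGraph V) (H : SimpleGraph W) :
    SimpleGraph (V × Option W) where
  Adj p q :=
    (p.2 = none ∧ q.2 = none ∧ G.Adj p.1 q.1) ∨
    (p.1 = q.1 ∧ ∃ w w' : W, p.2 = some w ∧ q.2 = some w' ∧ H.Adj w w') ∨
    (p.1 = q.1 ∧ Xor (p.2 = none) (q.2 = none))
  symm := ⟨by
    rintro p q (⟨h1, h2, h3⟩ | ⟨h1, w, w', h2, h3, h4⟩ | ⟨h1, h2⟩)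
    · exact Or.inl ⟨h2, h1, h3.symm⟩
    · exact Or.inr (Or.inl ⟨h1.symm, w', w, h3, h2, h4.symm⟩)
    · exact Or.inr (Or.inr ⟨h1.symm, h2.symm⟩)⟩
  loopless := ⟨by
    rintro p (⟨_, _, h3⟩ | ⟨_, w, w', h2, h3, h4⟩ | ⟨_, h2⟩)
    · exact h3.ne rfl
    · rw [h2] at h3
      exact h4.ne (Option.some.inj h3)
    · simp [Xor] at h2⟩

open Classical in
/-- The transition matrix `U(t) = exp(-i t A(G))` of the continuous-time quantum walk on `G`. -/
noncomputable def transitionMatrix {V : Type*} [Fintype V] (G : SimpleGraph V) (t : ℝ) :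
    Matrix V V ℂ :=
  NormedSpace.exp ((-(Complex.I * (t : ℂ))) • G.adjMatrix ℂ)

/-- The quantum walk on `G` has perfect state transfer between `u` and `v` at time `τ`:
the entry `⟨v| U(τ) |u⟩` is a unimodular complex number (the phase). -/
def HasPSTBetween {V : Type*} [Fintype V] (G : SimpleGraph V) (u v : V) (τ : ℝ) : Prop :=
  ∃ γ : ℂ, ‖γ‖ = 1 ∧ transitionMatrix G τ v u = γ

/-- `G` has perfect state transfer: it occurs between two distinct vertices at some time.
(The case of equal vertices is periodicity, and holds trivially at time `0`.) -/
def HasPST {V : Type*} [Fintype V] (G : SimpleGraph V) : Prop :=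
  ∃ u v : V, u ≠ v ∧ ∃ τ : ℝ, HasPSTBetween G u v τ

/-- The empty graph on `m` vertices, the complement of the complete graph `K_m`. -/
def emptyG (m : ℕ) : SimpleGraph (Fin m) := (⊤ : SimpleGraph (Fin m))ᶜ

/-- The star `K_{1,n}`. -/
def star (n : ℕ) : SimpleGraph (Fin 1 ⊕ Fin n) := completeBipartiteGraph (Fin 1) (Fin n)

end QuantumWalk

namespace QuantumWalk

/-! The matrix `U(τ)` is unitary, so transfer from `u` to `v` with phase `γ` means that row `v` has
its only nonzero entry, `γ`, at `u`. Applied to a real eigenvector `x` for `θ`, this gives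
`exp(-iτθ) x v = γ x u`, hence `|x v| = |x u|`. The proof contradicts these relations using two
families of corona eigenvectors: for each eigenpair `(x, μ)` of `G` and each root of `θ² = μθ + m`,
the vector `θx` on the base and `x` on every leaf; and differences of two leaves at one base vertex,
with eigenvalue `0`.

Transfer between a base vertex and a leaf would force the two roots to have equal absolute value, so
`μ = 0` throughout the support of a vertex that has a neighbour. Otherwise both ends are of the same
kind and `CoronaRel` holds. Squaring removes signs: `√(μ² + 4m)` and all differences `μ - ν` over
the support of `a` are integer multiples of `π/τ`. Since `μ` is an algebraic integer, a nonzero `μ²`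
is an integer `L` with `L(L + 4m)` a square (`sq_eq_of_ratio`). For `m` equal to one or a prime this
leaves only `m` prime and `μ = ±(m - 1)`, where the roots `θ` are integers and the phases can be
compared directly (`not_coronaRel`, `not_transferRel_some_some`).

For stars, the first part settles `m ≤ 2`. For `m ≥ 3` leaf differences exclude transfer between
leaves of the corona, and the base cases reduce to `K_{1,1}` and `K_{1,2}`, which fail by parity and
by the absence of consecutive positive squares. -/

open Classical in
/-- `x` is a real vector with `A(G) x = μ x`, written entrywise. -/
def IsEigen {V : Type*} [Fintype V] (G : SimpleGraph V) (x : V → ℝ) (μ : ℝ) : Prop :=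
  ∀ v, (∑ w, if G.Adj v w then x w else 0) = μ * x v

/-- The effect on real eigenvectors of perfect state transfer from `u` to `v` at time `τ` with
phase `γ`. -/
def TransferRel {V : Type*} [Fintype V] (G : SimpleGraph V) (u v : V) (τ : ℝ) (γ : ℂ) : Prop :=
  ∀ (x : V → ℝ) (μ : ℝ), IsEigen G x μ →
    Complex.exp (-(Complex.I * τ * μ)) * x v = γ * x u

/-! ### State transfer as a condition on eigenvectors -/

theorem exp_mulVec_of_mulVec_eq {V : Type*} [Fintype V] [DecidableEq V] (M : Matrix V V ℂ)
    (z : V → ℂ) (μ : ℂ) (h : M.mulVec z = μ • z) :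
    (NormedSpace.exp M).mulVec z = Complex.exp μ • z := by
  have hpow : ∀ n : ℕ, (M ^ n).mulVec z = μ ^ n • z := by
    intro n
    induction n with
    | zero => simp
    | succ n ih =>
      rw [pow_succ, ← Matrix.mulVec_mulVec, h, Matrix.mulVec_smul, ih, smul_smul, pow_succ']
  have h1 : HasSum (fun n : ℕ => ((n.factorial : ℂ)⁻¹) • M ^ n) (NormedSpace.exp M) := by
    open scoped Matrix.Norms.Operator in
    exact NormedSpace.exp_series_hasSum_exp' (𝕂 := ℂ) M
  have h2 := h1.map (Matrix.mulVec.addMonoidHomLeft z)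
    (by
      refine continuous_pi fun i => ?_
      simp only [Matrix.mulVec.addMonoidHomLeft, AddMonoidHom.coe_mk, ZeroHom.coe_mk,
        Matrix.mulVec, dotProduct]
      fun_prop)
  have h3 : HasSum (fun n : ℕ => ((n.factorial : ℂ)⁻¹) • μ ^ n) (NormedSpace.exp μ) :=
    NormedSpace.exp_series_hasSum_exp' (𝕂 := ℂ) μ
  have h4 := h3.smul_const z
  rw [← Complex.exp_eq_exp_ℂ] at h4
  refine h2.unique ?_
  convert h4 using 2 with n
  simp [Matrix.mulVec.addMonoidHomLeft, Matrix.smul_mulVec, hpow, smul_smul]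

theorem transitionMatrix_mulVec {V : Type*} [Fintype V] (G : SimpleGraph V) (τ : ℝ)
    (x : V → ℝ) (μ : ℝ) (h : IsEigen G x μ) :
    (transitionMatrix G τ).mulVec (fun w => (x w : ℂ)) =
      Complex.exp (-(Complex.I * τ * μ)) • fun w => (x w : ℂ) := by
  classical
  unfold transitionMatrix
  convert exp_mulVec_of_mulVec_eq _ (fun w => (x w : ℂ)) (-(Complex.I * τ * μ)) ?_
  ext v
  rw [Matrix.smul_mulVec]
  have := congrArg (fun r : ℝ => (r : ℂ)) (h v)
  simp only [Matrix.mulVec, dotProduct, SimpleGraph.adjMatrix_apply, Pi.smul_apply, smul_eq_mul,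
    ite_mul, one_mul, zero_mul]
  push_cast at this
  have e : (∑ w, if G.Adj v w then (x w : ℂ) else 0) = μ * x v := by
    rw [← this]; refine Finset.sum_congr rfl fun w _ => ?_
    split_ifs <;> simp
  linear_combination (-(Complex.I * τ)) * e

theorem transitionMatrix_mul_conjTranspose {V : Type*} [Fintype V] [DecidableEq V]
    (G : SimpleGraph V) (τ : ℝ) :
    transitionMatrix G τ * (transitionMatrix G τ).conjTranspose = 1 := by
  have : ∀ (M : Matrix V V ℂ), M.conjTranspose = -M →
      NormedSpace.exp M * (NormedSpace.exp M).conjTranspose = 1 := by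
    intro M hM
    rw [← Matrix.exp_conjTranspose, hM, Matrix.exp_neg]
    exact Matrix.mul_nonsing_inv _ ((Matrix.isUnit_iff_isUnit_det _).1 (Matrix.isUnit_exp M))
  unfold transitionMatrix
  convert this _ ?_
  ext i j
  by_cases hij : G.Adj i j <;> simp [hij, SimpleGraph.adjMatrix_apply, G.adj_comm j i]

theorem HasPSTBetween.transferRel {V : Type*} [Fintype V] {G : SimpleGraph V} {u v : V} {τ : ℝ}
    (h : HasPSTBetween G u v τ) : ∃ γ : ℂ, ‖γ‖ = 1 ∧ TransferRel G u v τ γ := by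
  classical
  obtain ⟨γ, hγ, hU⟩ := h
  refine ⟨γ, hγ, fun x μ hx => ?_⟩
  have h1 := congrFun (congrFun (transitionMatrix_mul_conjTranspose G τ) v) v
  rw [Matrix.mul_apply] at h1
  simp only [Matrix.conjTranspose_apply, Matrix.one_apply_eq] at h1
  have h2 : ∑ w, ‖transitionMatrix G τ v w‖ ^ 2 = 1 := by
    have : ∀ w, transitionMatrix G τ v w * Star.star (transitionMatrix G τ v w) =
        ((‖transitionMatrix G τ v w‖ ^ 2 : ℝ) : ℂ) := by
      intro w
      rw [Complex.star_def, Complex.mul_conj, Complex.normSq_eq_norm_sq]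
    simp only [this] at h1
    exact_mod_cast h1
  -- Row `v` has norm one and its entry at `u` already accounts for all of it.
  have h3 : ∀ w, w ≠ u → transitionMatrix G τ v w = 0 := by
    rw [← Finset.add_sum_erase _ _ (Finset.mem_univ u), hU, hγ] at h2
    have h4 : ∑ w ∈ Finset.univ.erase u, ‖transitionMatrix G τ v w‖ ^ 2 = 0 := by linarith
    rw [Finset.sum_eq_zero_iff_of_nonneg (fun _ _ => by positivity)] at h4
    intro w hw
    have := h4 w (by simp [hw])
    simpa using this
  have h4 := congrFun (transitionMatrix_mulVec G τ x μ hx) v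
  simp only [Matrix.mulVec, dotProduct, Pi.smul_apply, smul_eq_mul] at h4
  rw [Finset.sum_eq_single u (fun w _ hw => by rw [h3 w hw, zero_mul]) (by simp), hU] at h4
  exact h4.symm

theorem HasPSTBetween.time_ne_zero {V : Type*} [Fintype V] {G : SimpleGraph V} {u v : V} {τ : ℝ}
    (huv : u ≠ v) (h : HasPSTBetween G u v τ) : τ ≠ 0 := by
  classical
  rintro rfl
  obtain ⟨γ, hγ, hU⟩ := h
  have : transitionMatrix G 0 v u = 0 := by
    simp [transitionMatrix, NormedSpace.exp_zero, Matrix.one_apply_ne huv.symm]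
  rw [← hU, this] at hγ
  simp at hγ

theorem TransferRel.symm {V : Type*} [Fintype V] {G : SimpleGraph V} {u v : V} {τ : ℝ} {γ : ℂ}
    (hγ : ‖γ‖ = 1) (h : TransferRel G u v τ γ) : TransferRel G v u τ γ := by
  intro x μ hx
  have h1 := h x μ hx
  have h2 := congrArg (starRingEnd ℂ) h1
  simp only [map_mul, ← Complex.exp_conj, map_neg, Complex.conj_I, Complex.conj_ofReal] at h2
  have h3 : γ * (starRingEnd ℂ) γ = 1 := by
    rw [Complex.mul_conj, Complex.normSq_eq_norm_sq, hγ]; simp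
  have h4 : Complex.exp (-(Complex.I * τ * μ)) * Complex.exp (-(-Complex.I * τ * μ)) = 1 := by
    rw [← Complex.exp_add]; ring_nf; simp
  linear_combination (-γ * Complex.exp (-(Complex.I * τ * μ))) * h2 + γ * x v * h4
    - Complex.exp (-(Complex.I * τ * μ)) * x u * h3

theorem TransferRel.abs_eq {V : Type*} [Fintype V] {G : SimpleGraph V} {u v : V} {τ : ℝ} {γ : ℂ}
    (hγ : ‖γ‖ = 1) (h : TransferRel G u v τ γ) {x : V → ℝ} {μ : ℝ} (hx : IsEigen G x μ) :
    |x v| = |x u| := by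
  have := congrArg norm (h x μ hx)
  rw [norm_mul, norm_mul, hγ, Complex.norm_exp] at this
  simpa using this

/-! ### Eigenvectors of the corona and of the base graph -/

theorem isEigen_corona {V : Type*} [Fintype V] {G : SimpleGraph V} {m : ℕ} {x : V → ℝ} {μ θ : ℝ}
    (hx : IsEigen G x μ) (hθ : θ ^ 2 = μ * θ + m) :
    IsEigen (corona G (emptyG m))
      (fun p => match p.2 with | none => θ * x p.1 | some _ => x p.1) θ := by
  classical
  rintro ⟨v, s⟩
  have hv := hx v
  rw [Fintype.sum_prod_type]
  rcases s with _ | j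
  · simp only [Fintype.sum_option, corona, emptyG, Xor]
    simp [Finset.sum_add_distrib]
    have : (∑ w, if G.Adj v w then θ * x w else 0) = θ * (μ * x v) := by
      rw [← hv, Finset.mul_sum]
      exact Finset.sum_congr rfl fun w _ => by split_ifs <;> simp
    rw [this]
    linear_combination (-x v) * hθ
  · simp only [Fintype.sum_option, corona, emptyG, Xor]
    simp

theorem isEigen_corona_sub {V : Type*} [Fintype V] [DecidableEq V] (G : SimpleGraph V) {m : ℕ}
    (w : V) (j k : Fin m) :
    IsEigen (corona G (emptyG m))
      (fun p => (if p = (w, some j) then 1 else 0) - (if p = (w, some k) then 1 else 0)) 0 := by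
  classical
  rintro ⟨v, s⟩
  have e : ∀ p : V × Option (Fin m), (if (corona G (emptyG m)).Adj (v, s) p then
      ((if p = (w, some j) then (1 : ℝ) else 0) - (if p = (w, some k) then 1 else 0)) else 0) =
      (if p = (w, some j) then (if (corona G (emptyG m)).Adj (v, s) p then 1 else 0) else 0) -
      (if p = (w, some k) then (if (corona G (emptyG m)).Adj (v, s) p then 1 else 0) else 0) := by
    intro p
    split_ifs <;> simp
  simp only [e, Finset.sum_sub_distrib, Finset.sum_ite_eq', Finset.mem_univ, if_true]
  simp [corona, emptyG]

/-- The adjacency matrix is real symmetric, so its eigenvectors span. This turns a relation checked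
on all eigenvectors into an identity of vectors. -/
theorem eq_zero_of_isEigen {V : Type*} [Fintype V] (G : SimpleGraph V) (y : V → ℝ)
    (h : ∀ (x : V → ℝ) (μ : ℝ), IsEigen G x μ → ∑ v, x v * y v = 0) : y = 0 := by
  classical
  have hA : (G.adjMatrix ℝ).IsHermitian := by
    ext i j; simp [SimpleGraph.adjMatrix_apply, G.adj_comm]
  have h1 : ∀ i, inner ℝ (hA.eigenvectorBasis i) (WithLp.toLp 2 y) = 0 := by
    intro i
    have := h (hA.eigenvectorBasis i) (hA.eigenvalues i) (fun v => by
      have := congrFun (hA.mulVec_eigenvectorBasis i) v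
      simpa [Matrix.mulVec, dotProduct, SimpleGraph.adjMatrix_apply] using this)
    simpa [PiLp.inner_apply, mul_comm] using this
  have h2 : WithLp.toLp 2 y = 0 := by
    have := hA.eigenvectorBasis.sum_repr' (WithLp.toLp 2 y)
    simp only [h1, zero_smul, Finset.sum_const_zero] at this
    exact this.symm
  simpa using congrArg WithLp.ofLp h2

theorem IsEigen.isIntegral {V : Type*} [Fintype V] {G : SimpleGraph V} {x : V → ℝ} {μ : ℝ}
    (h : IsEigen G x μ) (hx : x ≠ 0) : IsIntegral ℤ μ := by
  classical
  refine ⟨(G.adjMatrix ℤ).charpoly, Matrix.charpoly_monic _, ?_⟩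
  have hmap : (G.adjMatrix ℤ).map (algebraMap ℤ ℝ) = G.adjMatrix ℝ := by
    ext i j; simp [SimpleGraph.adjMatrix_apply]
  rw [← Polynomial.eval_map, ← Matrix.charpoly_map, hmap, Matrix.eval_charpoly]
  refine Matrix.exists_mulVec_eq_zero_iff.1 ⟨x, hx, ?_⟩
  ext v
  have := h v
  rw [Matrix.sub_mulVec]
  simp only [Matrix.mulVec, dotProduct, SimpleGraph.adjMatrix_apply, Matrix.scalar_apply,
    Matrix.diagonal_apply, Pi.sub_apply, ite_mul, one_mul, zero_mul, this, Pi.zero_apply]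
  simp

/-- The row of `A(G)` at `a` paired with an eigenvector. -/
theorem IsEigen.sum_adj {V : Type*} [Fintype V] {G : SimpleGraph V} [DecidableRel G.Adj] {x : V → ℝ} {μ : ℝ} (h : IsEigen G x μ) (a : V) :
    ∑ w, x w * (if G.Adj a w then 1 else 0) = μ * x a := by
  rw [← h a]
  exact Finset.sum_congr rfl fun w _ => by split_ifs <;> simp

/-- In a connected graph on at least two vertices, the eigenvectors not vanishing at `a` do not all
belong to one eigenvalue. -/
theorem exists_isEigen_ne {V : Type*} [Fintype V] {G : SimpleGraph V} {a b : V} (hab : G.Adj a b)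
    (c : ℝ) : ∃ (x : V → ℝ) (μ : ℝ), IsEigen G x μ ∧ x a ≠ 0 ∧ μ ≠ c := by
  classical
  by_contra! hc
  -- Otherwise `A e_a - c e_a` is orthogonal to every eigenvector, hence zero, although its entry at
  -- `b` is nonzero.
  have h := eq_zero_of_isEigen G
    (fun w => (if G.Adj a w then 1 else 0) - c * (if w = a then 1 else 0)) (fun x μ hx => by
      simp only [mul_sub, Finset.sum_sub_distrib, hx.sum_adj]
      by_cases h0 : x a = 0
      · simp [h0]
      · simp [hc x μ hx h0]; ring)
  have := congrFun h b
  simp [hab, hab.ne'] at this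

/-! ### From equal phases to integer ratios -/

theorem phase_int {τ s : ℝ} (h : Complex.exp (-(Complex.I * τ * s)) ^ 2 = 1) :
    ∃ a : ℤ, τ * s = Real.pi * a := by
  rw [← Complex.exp_nat_mul, Complex.exp_eq_one_iff] at h
  obtain ⟨n, hn⟩ := h
  have h2 : Complex.I * ((τ * s : ℝ) : ℂ) = Complex.I * ((Real.pi * (-n : ℤ) : ℝ) : ℂ) := by
    push_cast at hn ⊢
    linear_combination (-1 / 2) * hn
  exact ⟨-n, by exact_mod_cast mul_left_cancel₀ Complex.I_ne_zero h2⟩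

/-- The two roots differ by `√(μ² + 4m)` and add up to `μ`; their phases have the same square. -/
theorem exists_int_of_roots {τ μ : ℝ} {γ : ℂ} {m : ℕ}
    (h : ∀ θ : ℝ, θ ^ 2 = μ * θ + m → Complex.exp (-(Complex.I * τ * θ)) ^ 2 = γ ^ 2) :
    (∃ a : ℤ, τ * √(μ ^ 2 + 4 * m) = Real.pi * a) ∧
      Complex.exp (-(Complex.I * τ * μ)) ^ 2 = γ ^ 4 := by
  set s := √(μ ^ 2 + 4 * m) with hs
  have hs2 : s ^ 2 = μ ^ 2 + 4 * m := Real.sq_sqrt (by positivity)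
  have h1 := h ((μ + s) / 2) (by linear_combination hs2 / 4)
  have h2 := h ((μ - s) / 2) (by linear_combination hs2 / 4)
  refine ⟨phase_int ?_, ?_⟩
  · have e : Complex.exp (-(Complex.I * τ * s)) * Complex.exp (-(Complex.I * τ * ((μ - s) / 2 : ℝ)))
        = Complex.exp (-(Complex.I * τ * ((μ + s) / 2 : ℝ))) := by
      rw [← Complex.exp_add]; congr 1; push_cast; ring
    have e2 : γ ^ 2 ≠ 0 := by rw [← h1]; exact pow_ne_zero _ (Complex.exp_ne_zero _)
    have e3 := congrArg (· ^ 2) e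
    simp only [mul_pow, h1, h2] at e3
    exact mul_right_cancel₀ e2 (by rw [e3, one_mul])
  · have e : Complex.exp (-(Complex.I * τ * μ)) = Complex.exp (-(Complex.I * τ * ((μ - s) / 2 : ℝ)))
        * Complex.exp (-(Complex.I * τ * ((μ + s) / 2 : ℝ))) := by
      rw [← Complex.exp_add]; congr 1; push_cast; ring
    rw [e, mul_pow, h1, h2]; ring

/-! ### Arithmetic of the ratio condition -/

/-- If `L (L + 4 m)` is a square with `L > 0` and `m` is one or a prime, then `m` is a prime and
`L = (m - 1) ^ 2`. -/
theorem eq_sq_of_mul_add_eq_sq {L s : ℤ} {m : ℕ} (hm : m = 1 ∨ m.Prime) (hL : 0 < L)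
    (h : L * (L + 4 * m) = s ^ 2) : L = (m - 1) ^ 2 := by
  wlog hs : 0 ≤ s generalizing s
  · exact this (s := -s) (by rw [h]; ring) (by omega)
  have hm0 : 0 < (m : ℤ) := by
    rcases hm with rfl | hm
    · norm_num
    · exact_mod_cast hm.pos
  have hpar : Even (L + 2 * m - s) := by
    have : Even (L * (L + 4 * m) - s ^ 2) := by rw [h]; simp
    simp only [Int.even_sub, Int.even_mul, Int.even_add, Int.even_pow] at this ⊢
    have h4 : Even (4 : ℤ) := by decide
    have h2 : Even (2 : ℤ) := by decide
    simp only [h4, h2] at this ⊢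
    tauto
  -- Here `(L + 2m)² - s² = 4m²`; halving both factors gives complementary divisors of `m²`, and `x`
  -- is one of them. The divisor `m` would give `L = 0`.
  obtain ⟨x, hx⟩ := hpar
  have hxs : s = L + 2 * m - 2 * x := by omega
  have hprod : x * (L + 2 * m - x) = m ^ 2 := by
    subst hxs; nlinarith
  have hy : 0 < L + 2 * m - x := by nlinarith
  have hx0 : 0 < x := by
    by_contra hc
    nlinarith [sq_pos_of_pos hm0]
  lift x to ℕ using hx0.le
  have hdvd : x ∣ m ^ 2 := by
    have : (x : ℤ) ∣ ((m ^ 2 : ℕ) : ℤ) := by push_cast; exact ⟨_, hprod.symm⟩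
    exact_mod_cast this
  rcases hm with rfl | hm
  · have : x = 1 := by simpa using hdvd
    subst this; push_cast at *; linarith
  · obtain ⟨k, hk, rfl⟩ := (Nat.dvd_prime_pow hm).1 hdvd
    push_cast at *
    interval_cases k
    · simp at *; linarith
    · have : (m : ℤ) * (L + 2 * m - m) = m * m := by linear_combination hprod
      have := mul_left_cancel₀ hm0.ne' this
      linarith
    · have : (m : ℤ) ^ 2 * (L + 2 * m - m ^ 2) = m ^ 2 * 1 := by linear_combination hprod
      have := mul_left_cancel₀ (pow_ne_zero 2 hm0.ne') this
      linarith

theorem exists_int_of_isIntegral_sq {μ : ℝ} (hint : IsIntegral ℤ μ) {q : ℚ} (hq : μ ^ 2 = q) :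
    ∃ L : ℤ, μ ^ 2 = L := by
  have h1 : IsIntegral ℤ (q : ℝ) := hq ▸ hint.pow 2
  have h2 : IsIntegral ℤ q := by
    have := (isIntegral_algebraMap_iff (R := ℤ) (A := ℚ) (B := ℝ) (x := q)
      (algebraMap ℚ ℝ).injective).1 (by simpa using h1)
    exact this
  obtain ⟨L, hL⟩ := IsIntegrallyClosed.isIntegral_iff.1 h2
  refine ⟨L, ?_⟩
  rw [hq, ← hL]; simp

/-- The arithmetic core: two distinct algebraic integers satisfying the ratio condition. -/
theorem sq_eq_of_ratio {α μ ν : ℝ} {a b n : ℤ} {m : ℕ} (hm : m = 1 ∨ m.Prime) (hμν : μ ≠ ν)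
    (hμ : IsIntegral ℤ μ) (h1 : μ ^ 2 + 4 * m = (α * a) ^ 2)
    (h2 : ν ^ 2 + 4 * m = (α * b) ^ 2) (h3 : μ - ν = α * n) (h0 : μ ≠ 0) :
    μ ^ 2 = (m - 1) ^ 2 := by
  have hn : (n : ℝ) ≠ 0 := by
    intro h; rw [h, mul_zero] at h3; exact hμν (sub_eq_zero.1 h3)
  have hα : α ≠ 0 := by
    rintro rfl; rw [zero_mul] at h3; exact hμν (sub_eq_zero.1 h3)
  have hm0 : 0 < m := by
    rcases hm with rfl | hm
    · norm_num
    · exact hm.pos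
  have hm0' : (0 : ℝ) < m := by exact_mod_cast hm0
  -- Subtracting `h2` from `h1` and dividing by `h3` makes `μ + ν`, like `μ - ν`, a rational
  -- multiple of `α`.
  obtain ⟨p, hp⟩ : ∃ p : ℚ, μ = α * p := by
    refine ⟨(n + (a ^ 2 - b ^ 2) / n) / 2, ?_⟩
    have h4 : (μ + ν) * n = α * (a ^ 2 - b ^ 2) := by
      apply mul_left_cancel₀ hα
      linear_combination (-(μ + ν)) * h3 + h1 - h2
    push_cast
    field_simp
    linear_combination n * h3 + h4
  have hp0 : (p : ℝ) ≠ 0 := by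
    intro h; rw [h, mul_zero] at hp; exact h0 hp
  have hp0' : p ≠ 0 := by exact_mod_cast hp0
  have h4 : 4 * (m : ℝ) = α ^ 2 * (a ^ 2 - p ^ 2) := by
    rw [hp] at h1; linear_combination h1
  have h5 : (a : ℝ) ^ 2 - p ^ 2 ≠ 0 := by
    intro h; rw [h] at h4; linarith
  -- Eliminating `α` between `μ = αp` and `4m = α²(a² - p²)` shows that `μ²` is rational.
  obtain ⟨L, hL⟩ := exists_int_of_isIntegral_sq hμ (q := 4 * m * p ^ 2 / (a ^ 2 - p ^ 2)) (by
    push_cast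
    rw [eq_div_iff h5, hp, h4]; ring)
  have hL0 : 0 < L := by
    have : (0 : ℝ) < L := by rw [← hL]; positivity
    exact_mod_cast this
  have h6 : L * (L + 4 * m) = (L * (a / p) : ℚ) ^ 2 := by
    have : (L : ℝ) * (L + 4 * m) = (L * (a / p)) ^ 2 := by
      rw [← hL]
      rw [show μ ^ 2 + 4 * m = μ ^ 2 * (a / p) ^ 2 by rw [h1, hp]; field_simp]
      ring
    exact_mod_cast this
  have h7 : IsSquare ((L * (L + 4 * m) : ℤ) : ℚ) := ⟨L * (a / p), by push_cast; rw [h6]; ring⟩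
  obtain ⟨s, hs⟩ := Rat.isSquare_intCast_iff.1 h7
  have := eq_sq_of_mul_add_eq_sq hm hL0 (by rw [hs]; ring : _ = s ^ 2)
  rw [hL, this]; push_cast; ring

theorem ne_sq_of_prime {m : ℕ} (hm : m.Prime) {q : ℚ} (h : (m : ℝ) = (q : ℝ) ^ 2) :
    False := by
  have h0 : (m : ℚ) = q ^ 2 := by exact_mod_cast h
  have h1 : IsSquare ((m : ℕ) : ℚ) := ⟨q, by rw [h0]; ring⟩
  have h2 := Rat.isSquare_natCast_iff.1 h1
  exact (Nat.prime_iff.1 hm).irreducible.not_isSquare h2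

/-- At most one of `μ`, `ν` vanishes. If `m = 1`, the nonzero one would have square `0`. If `m` is
prime and `μ = 0`, comparing `4m = (αa)²` with `(m + 1)² = (αb)²` makes `m` a rational square. -/
theorem prime_and_sq_eq_of_ratio {α μ ν : ℝ} {a b n : ℤ} {m : ℕ} (hm : m = 1 ∨ m.Prime)
    (hμν : μ ≠ ν) (hμ : IsIntegral ℤ μ) (hν : IsIntegral ℤ ν)
    (h1 : μ ^ 2 + 4 * m = (α * a) ^ 2) (h2 : ν ^ 2 + 4 * m = (α * b) ^ 2)
    (h3 : μ - ν = α * n) : m.Prime ∧ μ ^ 2 = (m - 1) ^ 2 := by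
  have h3' : ν - μ = α * (-n : ℤ) := by push_cast; linear_combination -h3
  have hprime : m.Prime := by
    rcases hm with rfl | hm
    · exfalso
      rcases eq_or_ne μ 0 with h | h
      · have := sq_eq_of_ratio (Or.inl rfl) hμν.symm hν h2 h1 h3' (fun h' => hμν (h.trans h'.symm))
        simp at this
        exact hμν (h.trans this.symm)
      · have := sq_eq_of_ratio (Or.inl rfl) hμν hμ h1 h2 h3 h
        simp at this
        exact h this
    · exact hm
  refine ⟨hprime, ?_⟩
  rcases eq_or_ne μ 0 with h | h
  · exfalso
    have h4 := sq_eq_of_ratio hm hμν.symm hν h2 h1 h3' (fun h' => hμν (h.trans h'.symm))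
    have h5 : ((m : ℝ) + 1) ^ 2 = (α * b) ^ 2 := by rw [← h2, h4]; ring
    have h6 : (b : ℝ) ≠ 0 := by
      intro hb; rw [hb] at h5; nlinarith [(m.cast_nonneg : (0 : ℝ) ≤ m)]
    refine ne_sq_of_prime hprime (q := a * (m + 1) / (2 * b)) ?_
    push_cast
    rw [h] at h1
    field_simp
    linear_combination (a ^ 2 : ℝ) * (-h5) + (b ^ 2 : ℝ) * h1
  · exact sq_eq_of_ratio hm hμν hμ h1 h2 h3 h

/-! ### Excluding transfer in coronas of connected graphs -/

/-- The relation that perfect state transfer between two vertices of the same kind of a corona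
`G ∘ emptyG m` imposes on the eigenvectors of `G`. -/
def CoronaRel {V : Type*} [Fintype V] (G : SimpleGraph V) (m : ℕ) (a b : V) (τ : ℝ) (γ : ℂ) :
    Prop :=
  ∀ (x : V → ℝ) (μ θ : ℝ), IsEigen G x μ → θ ^ 2 = μ * θ + m →
    Complex.exp (-(Complex.I * τ * θ)) * x b = γ * x a

section

variable {V : Type*} [Fintype V] {G : SimpleGraph V} {m : ℕ} {a b : V} {τ : ℝ} {γ : ℂ}

theorem TransferRel.coronaRel_none (hm : 1 ≤ m)
    (h : TransferRel (corona G (emptyG m)) (a, none) (b, none) τ γ) : CoronaRel G m a b τ γ := by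
  intro x μ θ hx hθ
  have h1 := h _ _ (isEigen_corona hx hθ)
  have h0 : (θ : ℂ) ≠ 0 := by
    norm_cast
    rintro rfl
    have : (1 : ℝ) ≤ m := by exact_mod_cast hm
    norm_num at hθ
    linarith
  push_cast at h1
  apply mul_left_cancel₀ h0
  linear_combination h1

theorem TransferRel.coronaRel_some {j k : Fin m}
    (h : TransferRel (corona G (emptyG m)) (a, some j) (b, some k) τ γ) :
    CoronaRel G m a b τ γ :=
  fun _ _ _ hx hθ => h _ _ (isEigen_corona hx hθ)

theorem not_transferRel_none_some (hm : 1 ≤ m) {c : V} (hac : G.Adj a c) {j : Fin m} (hγ : ‖γ‖ = 1)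
    (h : TransferRel (corona G (emptyG m)) (a, none) (b, some j) τ γ) : False := by
  obtain ⟨x, μ, hx, hxa, hμ⟩ := exists_isEigen_ne hac 0
  have hm' : (1 : ℝ) ≤ m := by exact_mod_cast hm
  set s := √(μ ^ 2 + 4 * m) with hs
  have hs2 : s ^ 2 = μ ^ 2 + 4 * m := Real.sq_sqrt (by positivity)
  have hs0 : s ≠ 0 := by
    intro h; rw [h] at hs2; nlinarith [sq_nonneg μ]
  have h1 := h.abs_eq hγ (isEigen_corona hx (θ := (μ + s) / 2) (by linear_combination hs2 / 4))
  have h2 := h.abs_eq hγ (isEigen_corona hx (θ := (μ - s) / 2) (by linear_combination hs2 / 4))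
  simp only [abs_mul] at h1 h2
  have h3 := mul_right_cancel₀ (abs_ne_zero.2 hxa) (h1.symm.trans h2)
  have h4 := (sq_eq_sq_iff_abs_eq_abs _ _).2 h3
  -- The squares of the two roots differ by `μ * s`.
  have h5 : μ * s = 0 := by linear_combination h4
  simp_all

theorem CoronaRel.abs_eq (h : CoronaRel G m a b τ γ) (hγ : ‖γ‖ = 1) {x : V → ℝ} {μ : ℝ}
    (hx : IsEigen G x μ) : |x b| = |x a| := by
  have hs2 : √(μ ^ 2 + 4 * m) ^ 2 = μ ^ 2 + 4 * m := Real.sq_sqrt (by positivity)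
  have := congrArg norm (h x μ ((μ + √(μ ^ 2 + 4 * m)) / 2) hx (by linear_combination hs2 / 4))
  rw [norm_mul, norm_mul, hγ, Complex.norm_exp] at this
  simpa using this

theorem CoronaRel.eigenvalue_sq (h : CoronaRel G m a b τ γ) (hγ : ‖γ‖ = 1) (hτ : τ ≠ 0)
    (hm : m = 1 ∨ m.Prime) {c : V} (hac : G.Adj a c) :
    m.Prime ∧ ∀ (x : V → ℝ) (μ : ℝ), IsEigen G x μ → x a ≠ 0 → μ ^ 2 = (m - 1) ^ 2 := by
  have key : ∀ (x : V → ℝ) (μ : ℝ), IsEigen G x μ → x a ≠ 0 →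
      m.Prime ∧ μ ^ 2 = (m - 1) ^ 2 := by
    intro x μ hx hxa
    obtain ⟨y, ν, hy, hya, hne⟩ := exists_isEigen_ne hac μ
    have roots : ∀ (z : V → ℝ) (ξ : ℝ), IsEigen G z ξ → z a ≠ 0 → ∀ θ : ℝ,
        θ ^ 2 = ξ * θ + m → Complex.exp (-(Complex.I * τ * θ)) ^ 2 = γ ^ 2 := by
      intro z ξ hz hza θ hθ
      have h1 := congrArg (· ^ 2) (h z ξ θ hz hθ)
      have h2 : ((z b : ℝ) : ℂ) ^ 2 = (z a : ℂ) ^ 2 := by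
        exact_mod_cast (sq_eq_sq_iff_abs_eq_abs _ _).2 (h.abs_eq hγ hz)
      simp only [mul_pow, h2] at h1
      exact mul_right_cancel₀ (pow_ne_zero 2 (by exact_mod_cast hza)) h1
    have hπ := Real.pi_ne_zero
    have sq : ∀ {ξ : ℝ} {i : ℤ}, τ * √(ξ ^ 2 + 4 * m) = Real.pi * i →
        ξ ^ 2 + 4 * m = (Real.pi / τ * i) ^ 2 := by
      intro ξ i hi
      rw [← Real.sq_sqrt (show 0 ≤ ξ ^ 2 + 4 * (m : ℝ) by positivity)]
      congr 1
      field_simp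
      linear_combination hi
    obtain ⟨⟨i, hi⟩, h1⟩ := exists_int_of_roots (roots x μ hx hxa)
    obtain ⟨⟨j, hj⟩, h2⟩ := exists_int_of_roots (roots y ν hy hya)
    obtain ⟨n, hn⟩ := phase_int (τ := τ) (s := μ - ν) (by
      have e : Complex.exp (-(Complex.I * τ * (μ - ν : ℝ))) * Complex.exp (-(Complex.I * τ * ν)) =
          Complex.exp (-(Complex.I * τ * μ)) := by
        rw [← Complex.exp_add]; congr 1; push_cast; ring
      have e3 := congrArg (· ^ 2) e
      simp only [mul_pow, h1, h2] at e3
      have e2 : γ ^ 4 ≠ 0 := pow_ne_zero _ (by rintro rfl; simp at hγ)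
      exact mul_right_cancel₀ e2 (by rw [e3, one_mul]))
    exact prime_and_sq_eq_of_ratio hm hne.symm (hx.isIntegral fun h => hxa (by simp [h]))
      (hy.isIntegral fun h => hya (by simp [h])) (sq hi) (sq hj)
      (by field_simp; linear_combination hn)
  obtain ⟨x, μ, hx, hxa, -⟩ := exists_isEigen_ne hac 0
  exact ⟨(key x μ hx hxa).1, fun x μ hx hxa => (key x μ hx hxa).2⟩

theorem exp_neg_I_mul_sq (τ : ℝ) :
    Complex.exp (-(Complex.I * τ * (2 : ℝ))) = Complex.exp (-(Complex.I * τ)) ^ 2 := by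
  rw [← Complex.exp_nat_mul]; congr 1; push_cast; ring

/-- Perfect state transfer does not occur between vertices of the base graph. -/
theorem not_coronaRel (hab : a ≠ b) (h : CoronaRel G m a b τ γ) (hγ : ‖γ‖ = 1) (hτ : τ ≠ 0)
    (hm : m = 1 ∨ m.Prime) {c : V} (hac : G.Adj a c) : False := by
  classical
  obtain ⟨hp, hsq⟩ := h.eigenvalue_sq hγ hτ hm hac
  have hm2 : (2 : ℝ) ≤ m := by exact_mod_cast hp.two_le
  have hval : ∀ (x : V → ℝ) (μ : ℝ), IsEigen G x μ → x a ≠ 0 → μ = m - 1 ∨ μ = -(m - 1) :=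
    fun x μ hx hxa => sq_eq_sq_iff_eq_or_eq_neg.1 (hsq x μ hx hxa)
  set E := Complex.exp (Complex.I * τ) with hE
  set F := Complex.exp (-(Complex.I * τ)) with hF
  have hEF : E * F = 1 := by rw [hE, hF, ← Complex.exp_add]; simp
  -- The roots are `m, -1` for `μ = m - 1` and `1, -m` for `μ = -(m - 1)`; the roots `∓1` suffice
  -- until the last case.
  have hplus : ∀ x : V → ℝ, IsEigen G x (m - 1) → E * x b = γ * x a := by
    intro x hx
    have := h x _ (-1) hx (by ring)
    rw [← this, hE]; congr 2; push_cast; ring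
  have hminus : ∀ x : V → ℝ, IsEigen G x (-(m - 1)) → F * x b = γ * x a := by
    intro x hx
    have := h x _ 1 hx (by ring)
    rw [← this, hF]; congr 2; push_cast; ring
  have sign : ∀ (x : V → ℝ) (μ : ℝ) (w : ℂ), IsEigen G x μ → x a ≠ 0 → w * x b = γ * x a →
      ∃ σ : ℝ, (σ = 1 ∨ σ = -1) ∧ w = σ * γ := by
    intro x μ w hx hxa hw
    have hxa' : (x a : ℂ) ≠ 0 := by exact_mod_cast hxa
    rcases abs_eq_abs.1 (h.abs_eq hγ hx) with e | e
    · refine ⟨1, Or.inl rfl, mul_right_cancel₀ hxa' ?_⟩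
      rw [e] at hw; rw [hw]; simp
    · refine ⟨-1, Or.inr rfl, mul_right_cancel₀ hxa' ?_⟩
      rw [e] at hw; push_cast at hw ⊢; linear_combination -hw
  have hγ0 : γ ≠ 0 := by rintro rfl; simp at hγ
  obtain ⟨x, μ, hx, hxa, hμ⟩ := exists_isEigen_ne hac (-((m : ℝ) - 1))
  obtain rfl := (hval x μ hx hxa).resolve_right hμ
  obtain ⟨y, ν, hy, hya, hν⟩ := exists_isEigen_ne hac ((m : ℝ) - 1)
  obtain rfl := (hval y ν hy hya).resolve_left hν
  obtain ⟨σ, hσ, hEσ⟩ := sign x _ E hx hxa (hplus x hx)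
  obtain ⟨ρ, hρ, hFρ⟩ := sign y _ F hy hya (hminus y hy)
  have real_of : ∀ (z : V → ℝ) (ε : ℝ), (ε : ℂ) * γ * z b = γ * z a → ε * z b = z a := by
    intro z ε hz
    have : (ε : ℂ) * z b = z a := mul_left_cancel₀ hγ0 (by linear_combination hz)
    exact_mod_cast this
  have hσ1 : ∀ z : V → ℝ, IsEigen G z (m - 1) → σ * z b = z a :=
    fun z hz => real_of z σ (hEσ ▸ hplus z hz)
  have hρ1 : ∀ z : V → ℝ, IsEigen G z (-(m - 1)) → ρ * z b = z a :=
    fun z hz => real_of z ρ (hFρ ▸ hminus z hz)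
  have hzero : ∀ (z : V → ℝ) (ξ : ℝ), IsEigen G z ξ → z a = 0 → z b = 0 := by
    intro z ξ hz h0
    have := h.abs_eq hγ hz
    rwa [h0, abs_zero, abs_eq_zero] at this
  -- Equal signs give `z a = σ z b` on all eigenvectors, hence `e_a = σ e_b`.
  by_cases hσρ : ρ = σ
  · have h0 := eq_zero_of_isEigen G
      (fun w => (if w = a then 1 else 0) - σ * (if w = b then 1 else 0)) (fun z ξ hz => by
        have : z a = σ * z b := by
          by_cases hza : z a = 0
          · rw [hza, hzero z ξ hz hza, mul_zero]
          · rcases hval z ξ hz hza with rfl | rfl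
            · exact (hσ1 z hz).symm
            · exact (hσρ ▸ hρ1 z hz).symm
        simp [mul_sub, Finset.sum_sub_distrib, this]; ring)
    have := congrFun h0 a
    simp [hab] at this
  -- Opposite signs give `A e_a = (m - 1)σ e_b`. So the neighbour `c` must be `b` and `m = 2`; the
  -- remaining root `2` then yields `F² = E`, incompatible with `F = -E` and `EF = 1`.
  · have hρσ : ρ = -σ := by
      rcases hσ with rfl | rfl <;> rcases hρ with rfl | rfl <;> simp_all
    have h0 := eq_zero_of_isEigen G
      (fun w => (if G.Adj a w then 1 else 0) - ((m - 1) * σ) * (if w = b then 1 else 0))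
      (fun z ξ hz => by
        have : ξ * z a = (m - 1) * σ * z b := by
          by_cases hza : z a = 0
          · rw [hza, hzero z ξ hz hza, mul_zero, mul_zero]
          · rcases hval z ξ hz hza with rfl | rfl
            · rw [← hσ1 z hz]; ring
            · rw [← hρ1 z hz, hρσ]; ring
        simp only [mul_sub, Finset.sum_sub_distrib, hz.sum_adj, this]
        simp; ring)
    have h1 := congrFun h0 c
    have h2 : (m : ℝ) = 2 := by
      by_cases hcb : c = b
      · rw [hcb] at h1 hac
        simp [hac] at h1
        rcases hσ with rfl | rfl <;> linarith
      · simp [hac, hcb] at h1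
    have h3 := h x _ 2 hx (by rw [h2]; norm_num)
    rw [← hplus x hx, exp_neg_I_mul_sq] at h3
    have hxb : (x b : ℂ) ≠ 0 := by
      intro hb
      have hb' : x b = 0 := by exact_mod_cast hb
      have := hσ1 x hx
      rw [hb', mul_zero] at this
      exact hxa this.symm
    have h4 : F ^ 2 = E := mul_right_cancel₀ hxb h3
    have h5 : F = -E := by rw [hFρ, hEσ, hρσ]; push_cast; ring
    have h6 : E * E = -1 := by rw [h5] at hEF; linear_combination -hEF
    have h7 : E = -1 := by rw [← h4, h5]; linear_combination h6
    rw [h7] at h6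
    norm_num at h6

/-- The difference of the leaves `j` and `l` at `a` is nonzero at the source, so it must be nonzero
at the target. The target is therefore the leaf `l`, and eigenvalue `0` together with the opposite
signs gives the phase. -/
theorem TransferRel.some_some {j k : Fin m} (hne : (a, some j) ≠ (b, some k)) (hγ : ‖γ‖ = 1)
    (h : TransferRel (corona G (emptyG m)) (a, some j) (b, some k) τ γ) {l : Fin m} (hl : l ≠ j) :
    l = k ∧ a = b ∧ γ = -1 := by
  classical
  have h1 := h.abs_eq hγ (isEigen_corona_sub G a j l)
  have h2 := h _ _ (isEigen_corona_sub G a j l)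
  have hv : ¬ (b = a ∧ k = j) := by
    rintro ⟨rfl, rfl⟩; exact hne rfl
  by_cases hbl : b = a ∧ k = l
  · obtain ⟨rfl, rfl⟩ := hbl
    refine ⟨rfl, rfl, ?_⟩
    simp [hl, hl.symm] at h2
    exact h2.symm
  · simp [hl.symm, hv, hbl] at h1

theorem TransferRel.le_two {j k : Fin m} (hne : (a, some j) ≠ (b, some k)) (hγ : ‖γ‖ = 1)
    (h : TransferRel (corona G (emptyG m)) (a, some j) (b, some k) τ γ) : m ≤ 2 := by
  by_contra! hm
  obtain ⟨l, -, hl⟩ := Finset.exists_mem_notMem_of_card_lt_card (s := {j, k}) (t := Finset.univ)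
    (Finset.card_le_two.trans_lt (by simpa using hm))
  simp only [Finset.mem_insert, Finset.mem_singleton, not_or] at hl
  exact hl.2 (h.some_some hne hγ hl.1).1

theorem not_transferRel_some_some {j k : Fin m} (hne : (a, some j) ≠ (b, some k)) (hγ : ‖γ‖ = 1)
    (hτ : τ ≠ 0) (hm : m = 1 ∨ m.Prime) {c : V} (hac : G.Adj a c)
    (h : TransferRel (corona G (emptyG m)) (a, some j) (b, some k) τ γ) : False := by
  by_cases hab : a = b
  · subst hab
    have hjk : j ≠ k := fun e => hne (by rw [e])
    obtain ⟨-, -, rfl⟩ := h.some_some hne hγ hjk.symm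
    have hH := h.coronaRel_some
    have hm2 : m = 2 := by
      have h1 := h.le_two hne hγ
      have := j.2; have := k.2; have := Fin.val_ne_of_ne hjk; omega
    subst hm2
    obtain ⟨-, hsq⟩ := hH.eigenvalue_sq hγ hτ hm hac
    obtain ⟨x, μ, hx, hxa, -⟩ := exists_isEigen_ne hac 0
    have hxa' : (x a : ℂ) ≠ 0 := by exact_mod_cast hxa
    have key : ∀ θ : ℝ, θ ^ 2 = μ * θ + (2 : ℕ) → Complex.exp (-(Complex.I * τ * θ)) = -1 :=
      fun θ hθ => mul_right_cancel₀ hxa' (hH x μ θ hx hθ)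
    have hε : μ = 1 ∨ μ = -1 := by
      have := hsq x μ hx hxa
      norm_num at this
      exact this
    -- With `m = 2` and `μ = ±1` the roots are `2μ` and `-μ`. Both have phase `-1`, yet `2μ + 2(-μ)
    -- = 0`.
    have h1 := key (2 * μ) (by rcases hε with e | e <;> rw [e] <;> norm_num)
    have h2 := key (-μ) (by rcases hε with e | e <;> rw [e] <;> norm_num)
    have h3 : Complex.exp (-(Complex.I * τ * (2 * μ : ℝ))) *
        Complex.exp (-(Complex.I * τ * (-μ : ℝ))) ^ 2 = 1 := by
      rw [← Complex.exp_nat_mul, ← Complex.exp_add]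
      rw [← Complex.exp_zero]; congr 1; push_cast; ring
    rw [h1, h2] at h3
    norm_num at h3
  · exact not_coronaRel hab h.coronaRel_some hγ hτ hm hac

end

theorem not_hasPST_corona {V : Type*} [Fintype V] (G : SimpleGraph V) (m : ℕ) (hG : G.Connected)
    (hV : 2 ≤ Fintype.card V) (hm : m = 1 ∨ m.Prime) : ¬ HasPST (corona G (emptyG m)) := by
  rintro ⟨⟨a, s⟩, ⟨b, t⟩, hne, τ, hpst⟩
  have hτ := hpst.time_ne_zero hne
  obtain ⟨γ, hγ, h⟩ := hpst.transferRel
  have hm1 : 1 ≤ m := by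
    rcases hm with rfl | hm
    · exact le_rfl
    · exact hm.one_le
  have : Nontrivial V := Fintype.one_lt_card_iff_nontrivial.1 hV
  have hadj : ∀ a, ∃ c, G.Adj a c := fun a => hG.preconnected.exists_adj_of_nontrivial a
  obtain ⟨c, hac⟩ := hadj a
  obtain ⟨d, hbd⟩ := hadj b
  rcases s with _ | j <;> rcases t with _ | k
  · exact not_coronaRel (fun e => hne (by rw [e])) (h.coronaRel_none hm1) hγ hτ hm hac
  · exact not_transferRel_none_some hm1 hac hγ h
  · exact not_transferRel_none_some hm1 hbd hγ (h.symm hγ)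
  · exact not_transferRel_some_some hne hγ hτ hm hac h

/-! ### Stars -/

theorem isEigen_star {n : ℕ} {s : ℝ} (hs : s ^ 2 = n) :
    IsEigen (star n) (Sum.elim (fun _ => s) (fun _ => 1)) s := by
  rintro (i | i)
  · simp [star]; linear_combination -hs
  · simp [star]

theorem isEigen_star_sub {n : ℕ} (i j : Fin n) :
    IsEigen (star n) (Sum.elim (fun _ => 0)
      (fun k => (if k = i then 1 else 0) - (if k = j then 1 else 0))) 0 := by
  rintro (k | k) <;> simp [star]

theorem exists_int_of_exp_eq_one {s : ℝ} (h : Complex.exp (-(Complex.I * s)) = 1) :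
    ∃ a : ℤ, s = Real.pi * (2 * a) := by
  obtain ⟨n, hn⟩ := Complex.exp_eq_one_iff.1 h
  have h2 : Complex.I * ((s : ℝ) : ℂ) = Complex.I * ((Real.pi * (2 * (-n : ℤ)) : ℝ) : ℂ) := by
    push_cast at hn ⊢
    linear_combination -hn
  exact ⟨-n, by exact_mod_cast mul_left_cancel₀ Complex.I_ne_zero h2⟩

theorem exp_neg_I_add (τ s t : ℝ) : Complex.exp (-(Complex.I * τ * (s + t : ℝ))) =
    Complex.exp (-(Complex.I * τ * s)) * Complex.exp (-(Complex.I * τ * t)) := by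
  rw [← Complex.exp_add]; congr 1; push_cast; ring

/-- Equal absolute values at centre and leaf force `n = 1`. Then `τ` is an odd multiple of `π` and
`τ√(1 + 4m)` an even one, contradicting parity after squaring. -/
theorem not_coronaRel_star_inl {n m : ℕ} {i : Fin 1} {j : Fin n} {τ : ℝ} {γ : ℂ}
    (hγ : ‖γ‖ = 1) (h : CoronaRel (star n) m (Sum.inl i) (Sum.inr j) τ γ) : False := by
  have h1 := h.abs_eq hγ (isEigen_star (s := √n) (Real.sq_sqrt (Nat.cast_nonneg n)))
  simp only [Sum.elim_inr, Sum.elim_inl, abs_one] at h1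
  rw [abs_of_nonneg (Real.sqrt_nonneg _), eq_comm, Real.sqrt_eq_one] at h1
  obtain rfl : n = 1 := by exact_mod_cast h1
  set s := √(1 + 4 * m) with hs
  have hs2 : s ^ 2 = 1 + 4 * m := Real.sq_sqrt (by positivity)
  have hp : ∀ θ : ℝ, θ ^ 2 = 1 * θ + m → Complex.exp (-(Complex.I * τ * θ)) = γ := by
    intro θ hθ
    simpa using h _ _ θ (isEigen_star (n := 1) (s := 1) (by norm_num)) hθ
  have hn : ∀ θ : ℝ, θ ^ 2 = -1 * θ + m → Complex.exp (-(Complex.I * τ * θ)) = -γ := by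
    intro θ hθ
    simpa using h _ _ θ (isEigen_star (n := 1) (s := -1) (by norm_num)) hθ
  have e1 := hp ((1 + s) / 2) (by linear_combination hs2 / 4)
  have e2 := hp ((1 - s) / 2) (by linear_combination hs2 / 4)
  have e3 := hn ((-1 + s) / 2) (by linear_combination hs2 / 4)
  -- The pairwise sums of the three roots are `0`, `1` and `s`; their phases give `γ² = -1`, then
  -- `-1` at `1` and `1` at `s`.
  have f1 := exp_neg_I_add τ ((1 - s) / 2) ((-1 + s) / 2)
  have f2 := exp_neg_I_add τ ((1 + s) / 2) ((1 - s) / 2)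
  have f3 := exp_neg_I_add τ ((1 + s) / 2) ((-1 + s) / 2)
  rw [e2, e3, show (1 - s) / 2 + (-1 + s) / 2 = 0 by ring] at f1
  rw [e1, e2, show (1 + s) / 2 + (1 - s) / 2 = 1 by ring] at f2
  rw [e1, e3, show (1 + s) / 2 + (-1 + s) / 2 = s by ring] at f3
  simp only [Complex.ofReal_zero, mul_zero, neg_zero, Complex.exp_zero] at f1
  have g1 : Complex.exp (-(Complex.I * τ * (1 : ℝ))) = -1 := by rw [f2]; linear_combination f1
  have g2 : Complex.exp (-(Complex.I * (τ * s : ℝ))) = 1 := by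
    rw [f1, ← f3]; congr 1; push_cast; ring
  obtain ⟨l, hl⟩ := exists_int_of_exp_eq_one g2
  obtain ⟨a, ha⟩ := phase_int (τ := τ) (s := 1) (by rw [g1]; norm_num)
  have hodd : Odd a := by
    by_contra hc
    obtain ⟨k, rfl⟩ := Int.not_odd_iff_even.1 hc
    have : Complex.exp (-(Complex.I * τ * (1 : ℝ))) = 1 := by
      rw [Complex.exp_eq_one_iff]
      refine ⟨-k, ?_⟩
      rw [mul_one] at ha
      rw [ha]; push_cast; ring
    rw [g1] at this
    norm_num at this
  rw [mul_one] at ha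
  have h5 : (a : ℝ) * s = 2 * l := by
    apply mul_left_cancel₀ Real.pi_ne_zero
    rw [← hl, ha]; ring
  have h6 : a ^ 2 * (1 + 4 * m) = 4 * l ^ 2 := by
    have : (a : ℝ) ^ 2 * (1 + 4 * m) = 4 * l ^ 2 := by
      rw [← hs2]; linear_combination (a * s + 2 * l) * h5
    exact_mod_cast this
  have h7 : Odd (a ^ 2 * (1 + 4 * (m : ℤ))) := hodd.pow.mul ⟨2 * m, by ring⟩
  rw [h6] at h7
  exact (Int.not_odd_iff_even.2 ⟨2 * l ^ 2, by ring⟩) h7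

/-- A third leaf is excluded by a difference of leaves, so `n = 2` with eigenvalues `±√2` and `0`.
The numbers `τ√2`, `τ√(2 + 4m)` and `τ√m` are then multiples of `π`, which makes both `2m` and `2m +
1` squares. -/
theorem not_coronaRel_star_inr {n m : ℕ} (hm : 1 ≤ m) {i j : Fin n} (hij : i ≠ j) {τ : ℝ}
    (hτ : τ ≠ 0) {γ : ℂ} (hγ : ‖γ‖ = 1)
    (h : CoronaRel (star n) m (Sum.inr i) (Sum.inr j) τ γ) : False := by
  have hall : ∀ k, k = i ∨ k = j := by
    by_contra! hk
    obtain ⟨k, hki, hkj⟩ := hk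
    have h1 := h.abs_eq hγ (isEigen_star_sub i k)
    simp [hij.symm, hki.symm, hkj.symm] at h1
  have hn : n = 2 := by
    have h1 : (Finset.univ : Finset (Fin n)) = {i, j} := by
      ext k; simpa using hall k
    have h2 := congrArg Finset.card h1
    rwa [Finset.card_univ, Fintype.card_fin, Finset.card_pair hij] at h2
  subst hn
  have hs2 : √(2 + 4 * m : ℝ) ^ 2 = 2 + 4 * m := Real.sq_sqrt (by positivity)
  have ht2 : √(2 : ℝ) ^ 2 = 2 := Real.sq_sqrt (by positivity)
  have hm2 : √(m : ℝ) ^ 2 = m := Real.sq_sqrt (by positivity)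
  set s := √(2 + 4 * m : ℝ)
  set t := √(2 : ℝ)
  set r := √(m : ℝ)
  have hp : ∀ ξ θ : ℝ, ξ ^ 2 = 2 → θ ^ 2 = ξ * θ + m →
      Complex.exp (-(Complex.I * τ * θ)) = γ := by
    intro ξ θ hξ hθ
    simpa using h _ _ θ (isEigen_star (n := 2) (s := ξ) (by rw [hξ]; norm_num)) hθ
  have hz := h _ _ r (isEigen_star_sub i j) (by rw [hm2]; ring)
  simp [hij, hij.symm] at hz
  have e1 := hp t ((t + s) / 2) ht2 (by linear_combination (hs2 - ht2) / 4)
  have e2 := hp t ((t - s) / 2) ht2 (by linear_combination (hs2 - ht2) / 4)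
  have e3 := hp (-t) ((-t + s) / 2) (by rw [neg_sq, ht2]) (by linear_combination (hs2 - ht2) / 4)
  -- The pairwise sums `0`, `t`, `s` all have phase `γ²`, so `γ² = 1`.
  have f1 := exp_neg_I_add τ ((t - s) / 2) ((-t + s) / 2)
  have f2 := exp_neg_I_add τ ((t + s) / 2) ((t - s) / 2)
  have f3 := exp_neg_I_add τ ((t + s) / 2) ((-t + s) / 2)
  rw [e2, e3, show (t - s) / 2 + (-t + s) / 2 = 0 by ring] at f1
  rw [e1, e2, show (t + s) / 2 + (t - s) / 2 = t by ring] at f2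
  rw [e1, e3, show (t + s) / 2 + (-t + s) / 2 = s by ring] at f3
  simp only [Complex.ofReal_zero, mul_zero, neg_zero, Complex.exp_zero] at f1
  obtain ⟨a, ha⟩ := phase_int (τ := τ) (s := t) (by rw [f2, ← f1]; norm_num)
  obtain ⟨b, hb⟩ := phase_int (τ := τ) (s := s) (by rw [f3, ← f1]; norm_num)
  obtain ⟨c, hc⟩ := phase_int (τ := τ) (s := r)
    (by linear_combination (γ - Complex.exp (-(Complex.I * τ * r))) * hz - f1)
  have hπ : Real.pi ^ 2 ≠ 0 := pow_ne_zero 2 Real.pi_ne_zero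
  have ha0 : a ≠ 0 := by
    rintro rfl
    have : τ * t = 0 := by rw [ha]; simp
    rcases mul_eq_zero.1 this with h0 | h0
    · exact hτ h0
    · rw [h0] at ht2; norm_num at ht2
  have ha2 : τ ^ 2 * 2 = Real.pi ^ 2 * a ^ 2 := by
    rw [← ht2]; linear_combination (τ * t + Real.pi * a) * ha
  have hb2 : τ ^ 2 * (2 + 4 * m) = Real.pi ^ 2 * b ^ 2 := by
    rw [← hs2]; linear_combination (τ * s + Real.pi * b) * hb
  have hc2 : τ ^ 2 * m = Real.pi ^ 2 * c ^ 2 := by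
    rw [← hm2]; linear_combination (τ * r + Real.pi * c) * hc
  have i1 : a ^ 2 * (2 * m) = (2 * c) ^ 2 := by
    have : (a : ℝ) ^ 2 * (2 * m) = (2 * c) ^ 2 := by
      apply mul_left_cancel₀ hπ
      linear_combination 4 * hc2 - (2 * m : ℝ) * ha2
    exact_mod_cast this
  have i2 : a ^ 2 * (2 * m + 1) = b ^ 2 := by
    have : (a : ℝ) ^ 2 * (2 * m + 1) = b ^ 2 := by
      apply mul_left_cancel₀ hπ
      linear_combination hb2 - (2 * m + 1 : ℝ) * ha2
    exact_mod_cast this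
  obtain ⟨d, hd⟩ : a ∣ 2 * c := (Int.pow_dvd_pow_iff two_ne_zero).1 ⟨_, i1.symm⟩
  obtain ⟨e, he⟩ : a ∣ b := (Int.pow_dvd_pow_iff two_ne_zero).1 ⟨_, i2.symm⟩
  have ha2' : a ^ 2 ≠ 0 := pow_ne_zero 2 ha0
  have j1 : 2 * (m : ℤ) = d ^ 2 := mul_left_cancel₀ ha2' (by rw [i1, hd]; ring)
  have j2 : 2 * (m : ℤ) + 1 = e ^ 2 := mul_left_cancel₀ ha2' (by rw [i2, he]; ring)
  have j3 : d.natAbs ^ 2 + 1 = e.natAbs ^ 2 := by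
    zify; rw [sq_abs, sq_abs]; linarith
  have j4 : 0 < d.natAbs := by
    rw [Int.natAbs_pos]; rintro rfl; omega
  have j5 : d.natAbs < e.natAbs := lt_of_pow_lt_pow_left₀ 2 (Nat.zero_le _) (by omega)
  nlinarith

theorem not_hasPST_corona_star (n m : ℕ) (hn : 1 ≤ n) (hm : 1 ≤ m) :
    ¬ HasPST (corona (star n) (emptyG m)) := by
  have hl : ∀ (i : Fin 1) (j : Fin n), (star n).Adj (Sum.inl i) (Sum.inr j) := by
    intro i j; simp [star]
  have hadj : ∀ a, ∃ c, (star n).Adj a c := by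
    rintro (i | j)
    · exact ⟨Sum.inr ⟨0, hn⟩, hl _ _⟩
    · exact ⟨Sum.inl 0, (hl _ _).symm⟩
  -- Here `m` is one or a prime, so the first part applies; for larger `m`, `TransferRel.le_two`
  -- excludes transfer between leaves of the corona.
  by_cases hm2 : m ≤ 2
  · have : m = 1 ∨ m.Prime := by
      interval_cases m
      · exact Or.inl rfl
      · exact Or.inr Nat.prime_two
    have hr : ∀ a, (star n).Reachable (Sum.inl 0) a := by
      rintro (i | j)
      · rw [Subsingleton.elim i 0]
      · exact (hl _ _).reachable
    exact not_hasPST_corona _ m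
      { preconnected := fun a b => (hr a).symm.trans (hr b)
        nonempty := ⟨Sum.inl 0⟩ } (by simp; omega) this
  rintro ⟨⟨a, s⟩, ⟨b, t⟩, hne, τ, hpst⟩
  have hτ := hpst.time_ne_zero hne
  obtain ⟨γ, hγ, h⟩ := hpst.transferRel
  obtain ⟨c, hac⟩ := hadj a
  obtain ⟨d, hbd⟩ := hadj b
  rcases s with _ | j <;> rcases t with _ | k
  · rcases a with i | i <;> rcases b with i' | i'
    · exact hne (by rw [Subsingleton.elim i i'])
    · exact not_coronaRel_star_inl hγ (h.coronaRel_none hm)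
    · exact not_coronaRel_star_inl hγ ((h.symm hγ).coronaRel_none hm)
    · exact not_coronaRel_star_inr hm (fun e => hne (by rw [e])) hτ hγ (h.coronaRel_none hm)
  · exact not_transferRel_none_some hm hac hγ h
  · exact not_transferRel_none_some hm hbd hγ (h.symm hγ)
  · exact hm2 (h.le_two hne hγ)

end QuantumWalk

theorem mainTheorem2 :
    (∀ {V : Type*} [Fintype V] (G : SimpleGraph V) (m : ℕ),
      G.Connected → 2 ≤ Fintype.card V → (m = 1 ∨ m.Prime) →
        ¬ QuantumWalk.HasPST (QuantumWalk.corona G (QuantumWalk.emptyG m))) ∧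
    (∀ n m : ℕ, 1 ≤ n → 1 ≤ m →
      ¬ QuantumWalk.HasPST (QuantumWalk.corona (QuantumWalk.star n) (QuantumWalk.emptyG m))) :=
  ⟨QuantumWalk.not_hasPST_corona, QuantumWalk.not_hasPST_corona_star⟩
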